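/- **Setting.** Let $n$ voters each rank $k$ alternatives; $S_k$ is the set of all total orderings of $[k]=\{1,\dots,k\}$. A social choice function (SCF) is a map $f:S_k^n\to[k]$, and the elements of $S_k^n$ are called profiles. A pair $(\sigma,\sigma')$ of profiles is a *manipulation pair* for $f$ if there is a voter $i$ such that $\sigma$ and $\sigma'$ differ only in the $i$-th coordinate and $f(\sigma')$ is ranked strictly above $f(\sigma)$ in $\sigma_i$; then $\sigma$ is a *manipulation point* of $f$, and $M(f)$ is the set of manipulation points. Let $\overline{\mathrm{NONMANIP}}$ be the set of all SCFs $g:S_k^n\to[k]$ that depend on only one coordinate or take at most two values. Put $\mathbf D(f,g)=\mathbb P(f(\sigma)\ne g(\sigma))$ for $\sigma$ uniform on $S_k^n$, and $\mathbf D(f,\overline{\mathrm{NONMANIP}})=\min_{g\in\overline{\mathrm{NONMANIP}}}\mathbf D(f,g)$. **Theorem 3.1.** Let $n\ge 2$, $k\ge 3$, let $\varepsilon$ be a real number, and let $f:S_k^n\to[k]$ be an SCF with $\mathbf D(f,\overline{\mathrm{NONMANIP}})\ge\varepsilon$. Then, for $\sigma$ uniform on $S_k^n$, $$\mathbb P(\sigma\in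 M(f))\ \ge\ \frac{\varepsilon^5}{4n^7k^{12}(k!)^4}.$$ Moreover, if $\sigma$ is uniform on $S_k^n$ and $\sigma'$ is obtained from $\sigma$ by choosing a voter $i\in\{1,\dots,n\}$ uniformly and replacing $\sigma_i$ by a uniformly random element of $S_k$ (all choices independent), then $$\mathbb P\big((\sigma,\sigma')\text{ is a manipulation pair for }f\big)\ \ge\ \frac{\varepsilon^5}{4n^8k^{12}(k!)^5}.$$ In particular, there are real polynomials $p,q$ in three variables, independent of $n,k,\varepsilon,f$ and strictly positive whenever all three arguments are positive, such that under the same hypotheses the two probabilities are at least $p(\varepsilon,\tfrac1n,\tfrac1{k!})$ and $q(\varepsilon,\tfrac1n,\tfrac1{k!})$, respectively. -/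

import Mathlib

namespace SocialChoice

/-- A ranking (total ordering) of the `k` alternatives, as the bijection from positions to
alternatives: `r 0` is the most preferred alternative, `r 1` the second one, and so on. -/
abbrev Ranking (k : ℕ) : Type := Equiv.Perm (Fin k)

/-- A ranking profile: one ranking for each of the `n` voters. -/
abbrev Profile (n k : ℕ) : Type := Fin n → Ranking k

/-- A social choice function on `n` voters and `k` alternatives. -/
abbrev SCF (n k : ℕ) : Type := Profile n k → Fin k

/-- `Prefers r a b`: the alternative `a` is ranked strictly above `b` in the ranking `r`. -/
def Prefers {k : ℕ} (r : Ranking k) (a b : Fin k) : Prop :=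
  r.symm a < r.symm b

/-- `(σ, σ')` is a manipulation pair for `f`: the two profiles differ only in the ranking of a
single voter `i`, and voter `i`, according to the ranking `σ i`, prefers the outcome at `σ'` to
the outcome at `σ`. -/
def IsManipulationPair {n k : ℕ} (f : SCF n k) (σ σ' : Profile n k) : Prop :=
  ∃ i : Fin n, (∀ j : Fin n, j ≠ i → σ' j = σ j) ∧ Prefers (σ i) (f σ') (f σ)

/-- The set `M(f)` of manipulation points of `f`. -/
def manipulationPoints {n k : ℕ} (f : SCF n k) : Set (Profile n k) :=
  {σ | ∃ σ' : Profile n k, IsManipulationPair f σ σ'}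

/-- `f` depends on (at most) one coordinate. -/
def DependsOnOneCoordinate {n k : ℕ} (f : SCF n k) : Prop :=
  ∃ (i : Fin n) (g : Ranking k → Fin k), ∀ σ : Profile n k, f σ = g (σ i)

/-- The class of social choice functions that only depend on one coordinate or take at most two
values. -/
def nonmanipBar (n k : ℕ) : Set (SCF n k) :=
  {f | DependsOnOneCoordinate f ∨ (Set.range f).ncard ≤ 2}

/-- The probability that a uniformly chosen element of the finite type `α` satisfies `P`. -/
noncomputable def uniformProb {α : Type*} [Fintype α] (P : α → Prop) : ℝ :=
  (Nat.card {x : α // P x} : ℝ) / (Fintype.card α : ℝ)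

/-- The distance of two social choice functions: the fraction of profiles on which they differ. -/
noncomputable def scfDist {n k : ℕ} (f g : SCF n k) : ℝ :=
  uniformProb (fun σ : Profile n k => f σ ≠ g σ)

/-- The distance of `f` to a class `G` of social choice functions. As there are only finitely many
social choice functions, the infimum over a nonempty class is a minimum. -/
noncomputable def distToClass {n k : ℕ} (f : SCF n k) (G : Set (SCF n k)) : ℝ :=
  sInf ((fun g => scfDist f g) '' G)

/-- The probability that `σ` is a manipulation point of `f`, for a uniform profile `σ`. -/
noncomputable def manipulationProb {n k : ℕ} (f : SCF n k) : ℝ :=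
  uniformProb (fun σ : Profile n k => σ ∈ manipulationPoints f)

/-- The probability that `(σ, σ')` is a manipulation pair for `f`, where the profile `σ`, the voter
`i` and the ranking `r` are independent and uniform, and `σ'` is obtained from `σ` by resetting
the ranking of voter `i` to `r`. -/
noncomputable def randomManipulationProb {n k : ℕ} (f : SCF n k) : ℝ :=
  uniformProb (fun x : Profile n k × Fin n × Ranking k =>
    IsManipulationPair f x.1 (Function.update x.1 x.2.1 x.2.2))

end SocialChoice

/-!
The proof is a count of profiles, with constants kept explicit. Call a profile *near* `(i, j)` if
changing the rankings of the voters `i` and `j` can produce a manipulation point; at most `k! ^ 2`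
profiles per manipulation point are near `(i, j)` (`card_nearManipulation_le`), so it suffices to
find many profiles near some pairs of voters.

Let `boundary f i a b` be the set of profiles with outcome `a` at which voter `i` can change the
outcome to `b`. An isoperimetric inequality for boxes (`card_mul_card_sdiff_le`) shows that, for `f`
far from the functions with two values, there are two large boundaries, for `(i, a, b)` and for
`(j, c, d)`, with `c ∉ {a, b}` (`exists_large_boundary`). Divide the profiles into fibres according
to how each voter orders `a` and `b`. A fibre is *large* if nearly all of its profiles belong to
`boundary f i a b`; in particular the outcome is then mostly `a`.

The two boundaries cannot both be carried by large fibres (`card_largeFibers_lt_or_lt`): the orders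
of `a, b` and of `c, d` have correlation at most `1/3` in absolute value, so by reverse
hypercontractivity a set of at least `δ ^ 3` of all profiles would be in large fibres for both
pairs, and most of these profiles would have the outcome `a` as well as the outcome `c ≠ a`.

Hence one of the boundaries, say the first one, has a large part in small fibres, and the
isoperimetric inequality inside these fibres gives many points at which a voter `j` leaves the
boundary without changing the order of `a` and `b`. If `j ≠ i`, consider the function of the
rankings of `i` and `j` alone: by the Gibbard–Satterthwaite theorem for two voters
(`IsStrategyproof.eq_left_or_eq_right`) the profile is near `(i, j)`
(`mem_nearManipulation_of_leave`). If `j = i`, the profile is near `(i, i)`, or voter `i` can choose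
between `a`, `b` and a third alternative. Profiles of the latter kind are grouped by the function
through which voter `i` chooses. No group contains more than the fraction `1 - ε` of all profiles,
because `f` is far from depending on voter `i` alone; so each group has a large boundary, and the
theorem for two voters, again, shows that this boundary is near some `(i, j)`
(`mul_card_takesThirdValue_le`).
-/

namespace SocialChoice

open Finset
open scoped Classical

/-! ### Vertex boundaries in boxes -/

/-- The points of `A` that leave `A` for a suitable change of their `j`-th coordinate to an element
of `S j`. -/
noncomputable def innerBoundary {n : ℕ} {R : Type*} [DecidableEq R] (S : Fin n → Finset R)
    (A : Finset (Fin n → R)) (j : Fin n) : Finset (Fin n → R) :=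
  {x ∈ A | ∃ r ∈ S j, Function.update x j r ∉ A}

/-- The point that agrees with `y` on the first `t` coordinates and with `x` on the others. -/
def hybrid {n : ℕ} {R : Type*} (x y : Fin n → R) (t : ℕ) : Fin n → R :=
  fun j => if (j : ℕ) < t then y j else x j

theorem update_hybrid {n : ℕ} {R : Type*} (x y : Fin n → R) (t : Fin n) :
    Function.update (hybrid x y t) t (y t) = hybrid x y (t + 1) := by
  ext j
  rcases eq_or_ne j t with rfl | h
  · simp [hybrid]
  · have : (j : ℕ) ≠ t := fun h' => h (Fin.ext h')
    have h2 : ((j : ℕ) < t + 1) ↔ (j : ℕ) < t := by omega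
    simp [hybrid, h, h2]

theorem hybrid_mem_piFinset {n : ℕ} {R : Type*} {S : Fin n → Finset R} {x y : Fin n → R}
    (hx : x ∈ Fintype.piFinset S) (hy : y ∈ Fintype.piFinset S) (t : ℕ) :
    hybrid x y t ∈ Fintype.piFinset S := by
  rw [Fintype.mem_piFinset] at *
  intro j
  unfold hybrid
  split_ifs
  exacts [hy j, hx j]

theorem exists_hybrid_mem_innerBoundary {n : ℕ} {R : Type*} [DecidableEq R] {S : Fin n → Finset R}
    {A : Finset (Fin n → R)} {x y : Fin n → R} (hx : x ∈ A) (hy : y ∈ Fintype.piFinset S)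
    (hyA : y ∉ A) : ∃ t : Fin n, hybrid x y t ∈ innerBoundary S A t := by
  by_contra! hcon
  have key : ∀ t : ℕ, t ≤ n → hybrid x y t ∈ A := by
    intro t
    induction t with
    | zero =>
      intro _
      have h0 : hybrid x y 0 = x := by ext j; simp [hybrid]
      rwa [h0]
    | succ t ih =>
      intro ht
      by_contra hA
      refine hcon ⟨t, ht⟩ (mem_filter.2 ⟨ih (by omega), y ⟨t, ht⟩, ?_, ?_⟩)
      · exact Fintype.mem_piFinset.1 hy _
      · rw [← update_hybrid x y ⟨t, ht⟩] at hA
        exact hA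
  have hn : hybrid x y n = y := by ext j; simp [hybrid]
  exact hyA (hn ▸ key n le_rfl)

/-- Isoperimetry in a box: a path from a point of `A` to a point of the complement, changing the
coordinates one after the other, crosses the boundary, and for every step `t` the two points are
recovered from the `t`-th point of the path and of the reverse path. -/
theorem card_mul_card_sdiff_le {n : ℕ} {R : Type*} [DecidableEq R] (S : Fin n → Finset R)
    (A : Finset (Fin n → R)) (hA : A ⊆ Fintype.piFinset S) :
    #A * #(Fintype.piFinset S \ A) ≤
      #(Fintype.piFinset S) * ∑ j, #(innerBoundary S A j) := by
  set P := Fintype.piFinset S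
  calc #A * #(P \ A) = #(A ×ˢ (P \ A)) := (card_product _ _).symm
    _ ≤ #((univ : Finset (Fin n)).biUnion fun t =>
          {p ∈ A ×ˢ (P \ A) | hybrid p.1 p.2 t ∈ innerBoundary S A t}) := by
        refine card_le_card fun p hp => ?_
        have hp' := mem_product.1 hp
        have h2 := mem_sdiff.1 hp'.2
        obtain ⟨t, ht⟩ := exists_hybrid_mem_innerBoundary hp'.1 h2.1 h2.2
        exact mem_biUnion.2 ⟨t, mem_univ _, mem_filter.2 ⟨hp, ht⟩⟩
    _ ≤ ∑ t, #{p ∈ A ×ˢ (P \ A) | hybrid p.1 p.2 t ∈ innerBoundary S A t} := card_biUnion_le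
    _ ≤ ∑ t, #(P ×ˢ innerBoundary S A t) := by
        refine sum_le_sum fun t _ => ?_
        refine card_le_card_of_injOn (fun p => (hybrid p.2 p.1 t, hybrid p.1 p.2 t)) ?_ ?_
        · intro p hp
          have hp := mem_filter.1 hp
          have hp' := mem_product.1 hp.1
          exact mem_product.2
            ⟨hybrid_mem_piFinset (mem_sdiff.1 hp'.2).1 (hA hp'.1) _, hp.2⟩
        · rintro ⟨x, y⟩ - ⟨x', y'⟩ - h
          simp only [Prod.mk.injEq] at h
          have h1 := fun j => congrFun h.1 j
          have h2 := fun j => congrFun h.2 j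
          simp only [hybrid] at h1 h2
          ext j
          · have h1 := h1 j; have h2 := h2 j; dsimp only; split_ifs at h1 h2 <;> assumption
          · have h1 := h1 j; have h2 := h2 j; dsimp only; split_ifs at h1 h2 <;> assumption
    _ = #P * ∑ j, #(innerBoundary S A j) := by simp [mul_sum]

/-! ### Reverse hypercontractivity -/

/-- The two-point inequality after the normalisation `s = (ac + bd)/2`, `t = (ad + bc)/2`,
`w = √((a² + b²)(c² + d²))/2`. -/
theorem cube_le_of_sq_add_sq {s t w : ℝ} (hs : 0 ≤ s) (ht : 0 ≤ t) (hsw : s ≤ w) (htw : t ≤ w)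
    (h : w ^ 2 ≤ s ^ 2 + t ^ 2) :
    3 * w ^ 3 ≤ 2 * s ^ 3 + 6 * s * (w ^ 2 - t ^ 2) + t ^ 3 + 3 * t * (w ^ 2 - s ^ 2) := by
  nlinarith [mul_nonneg (sub_nonneg.2 h) (sub_nonneg.2 hsw), mul_nonneg hs (sq_nonneg (w - s)),
    mul_nonneg ht (sq_nonneg (w - t)), mul_nonneg (sub_nonneg.2 htw) (sq_nonneg (w - t)),
    mul_nonneg (mul_nonneg hs ht) (sub_nonneg.2 htw),
    mul_nonneg (sub_nonneg.2 hsw) (sq_nonneg (w - s))]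

theorem two_point_inequality {a b c d : ℝ} (ha : 0 ≤ a) (hb : 0 ≤ b) (hc : 0 ≤ c) (hd : 0 ≤ d) :
    √((a ^ 2 + b ^ 2) / 2) ^ 3 * √((c ^ 2 + d ^ 2) / 2) ^ 3 ≤
      (a ^ 3 * c ^ 3 + b ^ 3 * d ^ 3) / 3 + (a ^ 3 * d ^ 3 + b ^ 3 * c ^ 3) / 6 := by
  set x := √((a ^ 2 + b ^ 2) / 2) with hx
  set y := √((c ^ 2 + d ^ 2) / 2) with hy
  have hx2 : x ^ 2 = (a ^ 2 + b ^ 2) / 2 := Real.sq_sqrt (by positivity)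
  have hy2 : y ^ 2 = (c ^ 2 + d ^ 2) / 2 := Real.sq_sqrt (by positivity)
  have hx0 : 0 ≤ x := Real.sqrt_nonneg _
  have hy0 : 0 ≤ y := Real.sqrt_nonneg _
  have hw : (x * y) ^ 2 = (a ^ 2 + b ^ 2) * (c ^ 2 + d ^ 2) / 4 := by rw [mul_pow, hx2, hy2]; ring
  have key := cube_le_of_sq_add_sq (s := (a * c + b * d) / 2) (t := (a * d + b * c) / 2)
    (w := x * y) (by positivity) (by positivity)
    (abs_le_of_sq_le_sq' (by rw [hw]; nlinarith [sq_nonneg (a * d - b * c)]) (by positivity)).2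
    (abs_le_of_sq_le_sq' (by rw [hw]; nlinarith [sq_nonneg (a * c - b * d)]) (by positivity)).2
    (by rw [hw]; nlinarith [mul_nonneg (mul_nonneg ha hb) (mul_nonneg hc hd)])
  rw [hw] at key
  rw [← mul_pow]
  linarith

/-- The pair `(u r, v r)`, for uniform `r`, satisfies the reverse hypercontractive inequality with
exponent `2/3`, here for the cubes of `φ` and `ψ`. -/
def ReverseHypercontractive {R U V : Type*} [Fintype R] (u : R → U) (v : R → V) : Prop :=
  ∀ (φ : U → ℝ) (ψ : V → ℝ), (∀ x, 0 ≤ φ x) → (∀ y, 0 ≤ ψ y) →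
    √((∑ r, φ (u r) ^ 2) / Fintype.card R) ^ 3 * √((∑ r, ψ (v r) ^ 2) / Fintype.card R) ^ 3 ≤
      (∑ r, φ (u r) ^ 3 * ψ (v r) ^ 3) / Fintype.card R

theorem sum_fin_cons {R : Type*} [Fintype R] {n : ℕ} (F : (Fin (n + 1) → R) → ℝ) :
    ∑ σ, F σ = ∑ r, ∑ τ : Fin n → R, F (Fin.cons r τ) := by
  rw [← (Fin.consEquiv fun _ : Fin (n + 1) => R).sum_comp, Fintype.sum_prod_type]
  rfl

theorem comp_fin_cons {R W : Type*} {n : ℕ} (w : R → W) (r : R) (τ : Fin n → R) :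
    (fun j => w ((Fin.cons r τ : Fin (n + 1) → R) j)) =
      (Fin.cons (w r) (fun j => w (τ j)) : Fin (n + 1) → W) := by
  ext j
  refine Fin.cases ?_ (fun j => ?_) j <;> simp

/-- The reverse hypercontractive inequality passes to products. -/
theorem ReverseHypercontractive.pi {R U V : Type*} [Fintype R] {u : R → U} {v : R → V}
    (h : ReverseHypercontractive u v) (n : ℕ) :
    ReverseHypercontractive (fun (σ : Fin n → R) j => u (σ j))
      (fun (σ : Fin n → R) j => v (σ j)) := by
  induction n with
  | zero =>
    intro φ ψ hφ hψ
    simp [Real.sqrt_sq, hφ, hψ]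
  | succ n ih =>
    intro φ ψ hφ hψ
    set Φ : U → ℝ := fun x => √((∑ τ : Fin n → R, φ (Fin.cons x fun j => u (τ j)) ^ 2) /
      Fintype.card (Fin n → R)) with hΦ
    set Ψ : V → ℝ := fun x => √((∑ τ : Fin n → R, ψ (Fin.cons x fun j => v (τ j)) ^ 2) /
      Fintype.card (Fin n → R)) with hΨ
    have hΦ2 : ∀ x, Φ x ^ 2 = (∑ τ : Fin n → R, φ (Fin.cons x fun j => u (τ j)) ^ 2) /
      Fintype.card (Fin n → R) := fun x => Real.sq_sqrt (by positivity)
    have hΨ2 : ∀ x, Ψ x ^ 2 = (∑ τ : Fin n → R, ψ (Fin.cons x fun j => v (τ j)) ^ 2) /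
      Fintype.card (Fin n → R) := fun x => Real.sq_sqrt (by positivity)
    have hcard : (Fintype.card (Fin (n + 1) → R) : ℝ) =
        Fintype.card (Fin n → R) * Fintype.card R := by
      simp [pow_succ]
    have h1 := h Φ Ψ (fun _ => Real.sqrt_nonneg _) (fun _ => Real.sqrt_nonneg _)
    simp only [hΦ2, hΨ2] at h1
    rw [← sum_div, ← sum_div, div_div, div_div, ← hcard] at h1
    simp only [sum_fin_cons]
    simp only [comp_fin_cons]
    refine h1.trans ?_
    rw [hcard, ← div_div, sum_div univ _ (Fintype.card (Fin n → R) : ℝ)]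
    refine div_le_div_of_nonneg_right (sum_le_sum fun r _ => ?_) (Nat.cast_nonneg _)
    exact ih (fun x => φ (Fin.cons (u r) x)) (fun y => ψ (Fin.cons (v r) y))
      (fun _ => hφ _) (fun _ => hψ _)

theorem ReverseHypercontractive.cube_mul_card_le {R U V : Type*} [Fintype R] {u : R → U} {v : R → V}
    (h : ReverseHypercontractive u v) (X : Set U) (Y : Set V) {δ : ℝ} (hδ : 0 ≤ δ)
    (hX : δ * Fintype.card R ≤ #{r | u r ∈ X}) (hY : δ * Fintype.card R ≤ #{r | v r ∈ Y}) :
    δ ^ 3 * Fintype.card R ≤ #{r | u r ∈ X ∧ v r ∈ Y} := by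
  rcases isEmpty_or_nonempty R with hR | hR
  · simp
  have hc : (0 : ℝ) < Fintype.card R := by exact_mod_cast Fintype.card_pos
  have key := h (fun x => if x ∈ X then 1 else 0) (fun y => if y ∈ Y then 1 else 0)
    (fun _ => by positivity) (fun _ => by positivity)
  have e1 : ∑ r, (if u r ∈ X then (1 : ℝ) else 0) ^ 2 = #{r | u r ∈ X} := by
    simp [ite_pow]
  have e2 : ∑ r, (if v r ∈ Y then (1 : ℝ) else 0) ^ 2 = #{r | v r ∈ Y} := by
    simp [ite_pow]
  have e3 : ∑ r, (if u r ∈ X then (1 : ℝ) else 0) ^ 3 * (if v r ∈ Y then (1 : ℝ) else 0) ^ 3 =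
      #{r | u r ∈ X ∧ v r ∈ Y} := by
    simp [ite_pow, ← ite_and, and_comm]
  simp only [e1, e2, e3] at key
  rw [← le_div_iff₀ hc] at hX hY ⊢
  refine le_trans ?_ key
  calc δ ^ 3 = √δ ^ 3 * √δ ^ 3 := by
        rw [← mul_pow, Real.mul_self_sqrt hδ]
    _ ≤ _ := by gcongr

/-! ### Joint law of two pairwise comparisons -/

/-- The relabelled rankings `e⁻¹ ∘ r`, for finitely many permutations `e` of the alternatives, are
all uniform, so that an average over the rankings can be computed by averaging over `e` first. -/
theorem card_mul_sum_ranking {k : ℕ} (l : List (Equiv.Perm (Fin k))) (F : Ranking k → ℝ) :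
    l.length * ∑ r, F r = ∑ r, (l.map fun e => F (e⁻¹ * r)).sum := by
  induction l with
  | nil => simp
  | cons e l ih =>
    simp only [List.length_cons, List.map_cons, List.sum_cons, sum_add_distrib, ← ih]
    have h : ∑ r, F (e⁻¹ * r) = ∑ r, F r := Equiv.sum_comp (Equiv.mulLeft e⁻¹) F
    rw [h]
    push_cast
    ring

/-- The order of `a` and `b` in the ranking `r`. -/
noncomputable def comparison {k : ℕ} (a b : Fin k) (r : Ranking k) : Bool :=
  decide (Prefers r a b)

theorem comparison_inv_mul {k : ℕ} (a b : Fin k) (e : Equiv.Perm (Fin k)) (r : Ranking k) :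
    comparison a b (e⁻¹ * r) = decide (r.symm (e a) < r.symm (e b)) := by
  exact decide_eq_decide.2 Iff.rfl

theorem sum_comparison {k : ℕ} {a b : Fin k} (hab : a ≠ b) (F : Bool → ℝ) :
    ∑ r : Ranking k, F (comparison a b r) =
      Fintype.card (Ranking k) * ((F true + F false) / 2) := by
  have key := card_mul_sum_ranking [1, Equiv.swap a b] (fun r => F (comparison a b r))
  have h : ∀ r : Ranking k, ([1, Equiv.swap a b].map fun e => F (comparison a b (e⁻¹ * r))).sum =
      F true + F false := by
    intro r
    simp only [comparison_inv_mul]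
    have hr : r.symm a ≠ r.symm b := fun h => hab (r.symm.injective h)
    rcases lt_or_gt_of_ne hr with h | h
    · simp [h, h.not_gt]
    · simp [h, h.not_gt, add_comm]
  simp only [h] at key
  simp at key ⊢
  linarith

/-- Comparisons of disjoint pairs of alternatives are independent. -/
theorem sum_comparison_disjoint {k : ℕ} {a b c d : Fin k} (hab : a ≠ b) (hcd : c ≠ d)
    (hca : c ≠ a) (hcb : c ≠ b) (hda : d ≠ a) (hdb : d ≠ b) (F G : Bool → ℝ) :
    ∑ r : Ranking k, F (comparison a b r) * G (comparison c d r) =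
      Fintype.card (Ranking k) * ((F true + F false) * (G true + G false) / 4) := by
  have key := card_mul_sum_ranking
    [1, Equiv.swap a b, Equiv.swap c d, Equiv.swap a b * Equiv.swap c d]
    (fun r => F (comparison a b r) * G (comparison c d r))
  have h : ∀ r : Ranking k, ([1, Equiv.swap a b, Equiv.swap c d,
      Equiv.swap a b * Equiv.swap c d].map
        fun e => F (comparison a b (e⁻¹ * r)) * G (comparison c d (e⁻¹ * r))).sum =
      (F true + F false) * (G true + G false) := by
    intro r
    simp only [comparison_inv_mul]
    have hr : r.symm a ≠ r.symm b := fun h => hab (r.symm.injective h)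
    have hr' : r.symm c ≠ r.symm d := fun h => hcd (r.symm.injective h)
    simp only [List.map_cons, List.map_nil, List.sum_cons, List.sum_nil, Equiv.Perm.coe_one, id,
      Equiv.Perm.coe_mul, Function.comp, Equiv.swap_apply_left, Equiv.swap_apply_right,
      Equiv.swap_apply_of_ne_of_ne hca hcb, Equiv.swap_apply_of_ne_of_ne hda hdb,
      Equiv.swap_apply_of_ne_of_ne hca.symm hda.symm,
      Equiv.swap_apply_of_ne_of_ne hcb.symm hdb.symm]
    rcases lt_or_gt_of_ne hr with h | h <;> rcases lt_or_gt_of_ne hr' with h' | h' <;>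
      simp [h, h.not_gt, h', h'.not_gt] <;> ring
  simp only [h] at key
  simp at key ⊢
  linarith

/-- Comparisons of two pairs with a common alternative are correlated: on three alternatives, each
pattern is realised by one or two of the six orders. -/
theorem sum_comparison_left {k : ℕ} {a b c : Fin k} (hab : a ≠ b) (hca : c ≠ a) (hcb : c ≠ b)
    (F G : Bool → ℝ) :
    ∑ r : Ranking k, F (comparison a b r) * G (comparison c a r) =
      Fintype.card (Ranking k) * ((F true * G false + F false * G true) / 3 +
        (F true * G true + F false * G false) / 6) := by
  have key := card_mul_sum_ranking
    [1, Equiv.swap a b, Equiv.swap a c, Equiv.swap b c, Equiv.swap a b * Equiv.swap a c,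
      Equiv.swap a b * Equiv.swap b c]
    (fun r => F (comparison a b r) * G (comparison c a r))
  have h : ∀ r : Ranking k, ([1, Equiv.swap a b, Equiv.swap a c, Equiv.swap b c,
      Equiv.swap a b * Equiv.swap a c, Equiv.swap a b * Equiv.swap b c].map
        fun e => F (comparison a b (e⁻¹ * r)) * G (comparison c a (e⁻¹ * r))).sum =
      2 * (F true * G false + F false * G true) + (F true * G true + F false * G false) := by
    intro r
    simp only [comparison_inv_mul]
    have h1 : r.symm a ≠ r.symm b := fun h => hab (r.symm.injective h)
    have h2 : r.symm c ≠ r.symm a := fun h => hca (r.symm.injective h)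
    have h3 : r.symm c ≠ r.symm b := fun h => hcb (r.symm.injective h)
    simp only [List.map_cons, List.map_nil, List.sum_cons, List.sum_nil, Equiv.Perm.coe_one, id,
      Equiv.Perm.coe_mul, Function.comp, Equiv.swap_apply_left, Equiv.swap_apply_right,
      Equiv.swap_apply_of_ne_of_ne hca hcb, Equiv.swap_apply_of_ne_of_ne hab hca.symm,
      Equiv.swap_apply_of_ne_of_ne hab.symm hcb.symm]
    rcases lt_or_gt_of_ne h1 with h1 | h1 <;> rcases lt_or_gt_of_ne h2 with h2 | h2 <;>
      rcases lt_or_gt_of_ne h3 with h3 | h3 <;>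
      first
      | (exfalso; order)
      | (simp only [h1, h1.not_gt, h2, h2.not_gt, h3, h3.not_gt, decide_true, decide_false]; ring)
  simp only [h] at key
  simp at key ⊢
  linarith

theorem comparison_swap {k : ℕ} {a b : Fin k} (hab : a ≠ b) (r : Ranking k) :
    comparison b a r = !comparison a b r := by
  have hr : r.symm a ≠ r.symm b := fun h => hab (r.symm.injective h)
  rcases lt_or_gt_of_ne hr with h | h <;> simp [comparison, Prefers, h, h.not_gt]

theorem reverseHypercontractive_comparison {k : ℕ} {a b c d : Fin k} (hab : a ≠ b) (hcd : c ≠ d)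
    (hca : c ≠ a) (hcb : c ≠ b) :
    ReverseHypercontractive (comparison a b) (comparison c d) := by
  intro φ ψ hφ hψ
  have hN : (Fintype.card (Ranking k) : ℝ) ≠ 0 := by
    exact_mod_cast Fintype.card_ne_zero
  rw [sum_comparison hab fun x => φ x ^ 2, sum_comparison hcd fun x => ψ x ^ 2,
    mul_div_cancel_left₀ _ hN, mul_div_cancel_left₀ _ hN]
  have t1 := two_point_inequality (hφ true) (hφ false) (hψ true) (hψ false)
  have t2 := two_point_inequality (hφ true) (hφ false) (hψ false) (hψ true)
  rw [add_comm (ψ false ^ 2)] at t2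
  rcases eq_or_ne d a with rfl | hda
  · rw [sum_comparison_left hab hca hcb (fun x => φ x ^ 3) (fun x => ψ x ^ 3),
      mul_div_cancel_left₀ _ hN]
    exact t2
  rcases eq_or_ne d b with rfl | hdb
  · have := sum_comparison_left hab.symm hcb hca (fun x => φ (!x) ^ 3) (fun x => ψ x ^ 3)
    simp only [comparison_swap hab, Bool.not_not] at this
    rw [this, mul_div_cancel_left₀ _ hN]
    simp only [Bool.not_true, Bool.not_false]
    linarith
  · rw [sum_comparison_disjoint hab hcd hca hcb hda hdb (fun x => φ x ^ 3) (fun x => ψ x ^ 3),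
      mul_div_cancel_left₀ _ hN]
    -- the uniform law is the average of the two correlated ones
    linarith

/-! ### The Gibbard–Satterthwaite theorem for two voters -/

/-- No voter can profit from misreporting in the social choice function `h` of two voters. -/
def IsStrategyproof {k : ℕ} (h : Ranking k → Ranking k → Fin k) : Prop :=
  (∀ r s r', ¬ Prefers r (h r' s) (h r s)) ∧ ∀ r s s', ¬ Prefers s (h r s') (h r s)

/-- `x` is the best alternative of `A` according to `r`. -/
def IsTop {k : ℕ} (A : Set (Fin k)) (r : Ranking k) (x : Fin k) : Prop :=
  ∀ y ∈ A, y ≠ x → Prefers r x y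

/-- The outcome is `x` whenever the first voter ranks `x` on top. -/
def Forces {k : ℕ} (A : Set (Fin k)) (h : Ranking k → Ranking k → Fin k) (x : Fin k) : Prop :=
  ∀ r s, IsTop A r x → h r s = x

theorem Prefers.asymm {k : ℕ} {r : Ranking k} {a b : Fin k} (h : Prefers r a b) :
    ¬ Prefers r b a :=
  lt_asymm h

theorem prefers_or_prefers {k : ℕ} (r : Ranking k) {a b : Fin k} (h : a ≠ b) :
    Prefers r a b ∨ Prefers r b a :=
  lt_or_gt_of_ne fun h' => h (r.symm.injective h')

theorem exists_ranking {k : ℕ} {x y p q : Fin k} (hxy : x ≠ y) (hpq : p ≠ q) :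
    ∃ r : Ranking k, r.symm x = p ∧ r.symm y = q := by
  refine ⟨Equiv.swap p x * Equiv.swap q (Equiv.swap p x y), ?_, ?_⟩
  · rw [Equiv.symm_apply_eq]
    have h : p ≠ Equiv.swap p x y :=
      fun h => hxy ((Equiv.swap p x).injective ((Equiv.swap_apply_right p x).trans h))
    simp [Equiv.swap_apply_of_ne_of_ne hpq h]
  · rw [Equiv.symm_apply_eq]
    simp

theorem exists_isTop {k : ℕ} (hk : 3 ≤ k) (A : Set (Fin k)) {x y : Fin k} (hxy : x ≠ y) :
    ∃ r : Ranking k, IsTop A r x ∧ ∀ z, z ≠ x → z ≠ y → Prefers r y z := by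
  obtain ⟨r, hx, hy⟩ := exists_ranking hxy (p := ⟨0, by omega⟩) (q := ⟨1, by omega⟩)
    (by simp)
  have h0 : ∀ z, z ≠ x → (r.symm z : ℕ) ≠ 0 := fun z hz h =>
    hz (r.symm.injective (by rw [hx]; exact Fin.ext h))
  have h1 : ∀ z, z ≠ y → (r.symm z : ℕ) ≠ 1 := fun z hz h =>
    hz (r.symm.injective (by rw [hy]; exact Fin.ext h))
  refine ⟨r, fun z _ hz => ?_, fun z hz hz' => ?_⟩
  · have := h0 z hz
    rw [Prefers, hx, Fin.lt_def]; simp only; omega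
  · have := h0 z hz
    have := h1 z hz'
    rw [Prefers, hy, Fin.lt_def]; simp only; omega

theorem exists_isTop_and_last {k : ℕ} (hk : 3 ≤ k) (A : Set (Fin k)) {x y : Fin k} (hxy : x ≠ y) :
    ∃ r : Ranking k, IsTop A r x ∧ ∀ z, z ≠ y → Prefers r z y := by
  obtain ⟨r, hx, hy⟩ := exists_ranking hxy (p := ⟨0, by omega⟩) (q := ⟨k - 1, by omega⟩)
    (by simp; omega)
  have h0 : ∀ z, z ≠ x → (r.symm z : ℕ) ≠ 0 := fun z hz h =>
    hz (r.symm.injective (by rw [hx]; exact Fin.ext h))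
  have h1 : ∀ z, z ≠ y → (r.symm z : ℕ) ≠ k - 1 := fun z hz h =>
    hz (r.symm.injective (by rw [hy]; exact Fin.ext h))
  refine ⟨r, fun z _ hz => ?_, fun z hz => ?_⟩
  · have := h0 z hz
    rw [Prefers, hx, Fin.lt_def]; simp only; omega
  · have := h1 z hz
    rw [Prefers, hy, Fin.lt_def]; simp only; omega

theorem IsStrategyproof.swap {k : ℕ} {h : Ranking k → Ranking k → Fin k} (hh : IsStrategyproof h) :
    IsStrategyproof fun r s => h s r :=
  ⟨fun r s r' => hh.2 s r r', fun r s s' => hh.1 s r s'⟩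

/-- Monotonicity: an outcome survives if no alternative overtakes it in the ranking of the first
voter. -/
theorem IsStrategyproof.eq_of_prefers_imp {k : ℕ} {h : Ranking k → Ranking k → Fin k}
    (hh : IsStrategyproof h) {r r' s : Ranking k} {x : Fin k} (hx : h r s = x)
    (hr : Prefers r x (h r' s) → Prefers r' x (h r' s)) : h r' s = x := by
  by_contra hne
  have h1 := hh.1 r s r'
  have h2 := hh.1 r' s r
  rw [hx] at h1 h2
  rcases prefers_or_prefers r hne with h | h
  · exact h1 h
  · exact h2 (hr h)

section

variable {k : ℕ} {h : Ranking k → Ranking k → Fin k} {A : Set (Fin k)}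

theorem IsStrategyproof.eq_of_isTop (hh : IsStrategyproof h) (hA : ∀ r s, h r s ∈ A)
    {r r' s : Ranking k} {x : Fin k} (hx : h r s = x) (hr : IsTop A r' x) : h r' s = x := by
  by_contra hne
  exact hne (hh.eq_of_prefers_imp hx fun _ => hr _ (hA _ _) hne)

theorem IsStrategyproof.eq_of_isTop_of_isTop (hh : IsStrategyproof h) (hA : ∀ r s, h r s ∈ A)
    {r s : Ranking k} {x : Fin k} (hx : ∃ r s, h r s = x) (hr : IsTop A r x) (hs : IsTop A s x) :
    h r s = x := by
  obtain ⟨r₀, s₀, h0⟩ := hx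
  exact hh.swap.eq_of_isTop (fun r s => hA s r) (hh.eq_of_isTop hA h0 hr) hs

/-- If a first voter who ranks `y` above all alternatives but `x` gets `x` against a second voter
who ranks `y` first, then the first voter can force `x`: the second voter might as well rank `x`
last. -/
theorem IsStrategyproof.forces_of_eq (hh : IsStrategyproof h) (hk : 3 ≤ k)
    (hA : ∀ r s, h r s ∈ A) {x y : Fin k} (hxy : x ≠ y) (hy : ∃ r s, h r s = y) {r s : Ranking k}
    (hr : ∀ z, z ≠ x → z ≠ y → Prefers r y z)
    (hs : IsTop A s y) (hx : h r s = x) :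
    Forces A h x := by
  obtain ⟨t, ht, ht'⟩ := exists_isTop_and_last hk A hxy.symm
  have hrt : h r t = x := by
    by_contra h1
    have h2 : h r t ≠ y := by
      intro h2
      have := hh.2 r s t
      rw [h2, hx] at this
      exact this (hs x (hx ▸ hA r s) hxy)
    -- the first voter could get `y` by ranking it first, as the second voter does
    have h3 := hh.1 r t t
    rw [hh.eq_of_isTop_of_isTop hA hy ht ht] at h3
    exact h3 (hr _ h1 h2)
  intro r' s'
  have h4 : h r s' = x := by
    by_contra hne
    exact hne (hh.swap.eq_of_prefers_imp hrt fun h5 => absurd h5 (ht' _ hne).asymm)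
  exact hh.eq_of_isTop hA h4

theorem IsStrategyproof.forces_or_forces (hh : IsStrategyproof h) (hk : 3 ≤ k)
    (hA : ∀ r s, h r s ∈ A) {x y : Fin k} (hxy : x ≠ y) (hx : ∃ r s, h r s = x)
    (hy : ∃ r s, h r s = y) : Forces A h x ∨ Forces A (fun r s => h s r) y := by
  obtain ⟨r, hr, hr'⟩ := exists_isTop hk A hxy
  obtain ⟨s, hs, hs'⟩ := exists_isTop hk A hxy.symm
  by_cases h1 : h r s = x
  · exact Or.inl (hh.forces_of_eq hk hA hxy hy hr' hs h1)
  · have h2 : h r s = y := by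
      by_contra h2
      have h3 := hh.2 r s r
      rw [hh.eq_of_isTop_of_isTop hA hx hr hr] at h3
      exact h3 (hs' _ h2 h1)
    obtain ⟨r₀, s₀, hx⟩ := hx
    exact Or.inr (hh.swap.forces_of_eq hk (fun r s => hA s r) hxy.symm ⟨s₀, r₀, hx⟩ hs' hr h2)

end

theorem exists_ranking_isTop {k : ℕ} (A : Set (Fin k)) (hA : A.Nonempty) (r : Ranking k) :
    ∃ x ∈ A, IsTop A r x := by
  obtain ⟨x, hx, h⟩ := Set.exists_min_image A r.symm (Set.toFinite A) hA
  exact ⟨x, hx, fun y hy hyx => lt_of_le_of_ne (h y hy) fun h' => hyx (r.symm.injective h'.symm)⟩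

theorem eq_left_of_forces {k : ℕ} {h : Ranking k → Ranking k → Fin k}
    (hf : ∀ x, (∃ r s, h r s = x) → Forces {x | ∃ r s, h r s = x} h x) (r s s' : Ranking k) :
    h r s = h r s' := by
  obtain ⟨x, hx, hr⟩ := exists_ranking_isTop {x | ∃ r s, h r s = x} ⟨h r s, r, s, rfl⟩ r
  rw [hf x hx r s hr, hf x hx r s' hr]

/-- The Gibbard–Satterthwaite theorem for two voters. -/
theorem IsStrategyproof.eq_left_or_eq_right {k : ℕ} {h : Ranking k → Ranking k → Fin k}
    (hh : IsStrategyproof h) (hk : 3 ≤ k) {a b : Fin k} (hab : a ≠ b) (ha : ∃ r s, h r s = a)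
    (hb : ∃ r s, h r s = b) (hc : ∃ r s, h r s ≠ a ∧ h r s ≠ b) :
    (∀ r s s', h r s = h r s') ∨ ∀ r r' s, h r s = h r' s := by
  set A : Set (Fin k) := {x | ∃ r s, h r s = x} with hAdef
  have hA : ∀ r s, h r s ∈ A := fun r s => ⟨r, s, rfl⟩
  obtain ⟨r₀, s₀, hca, hcb⟩ := hc
  set c := h r₀ s₀
  have hcA : c ∈ A := hA _ _
  have hswap : ∀ x, x ∈ A → ∃ r s, h s r = x := fun x ⟨r, s, hx⟩ => ⟨s, r, hx⟩
  -- two different alternatives cannot be forced by the two voters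
  have hno : ∀ x y, x ≠ y → Forces A h x → Forces A (fun r s => h s r) y → False := by
    intro x y hxy h1 h2
    obtain ⟨r, hr, -⟩ := exists_isTop hk A hxy
    obtain ⟨s, hs, -⟩ := exists_isTop hk A hxy.symm
    exact hxy ((h1 r s hr).symm.trans (h2 s r hs))
  by_cases hex : ∃ x ∈ A, Forces A h x
  · left
    obtain ⟨x, hx, hf⟩ := hex
    refine eq_left_of_forces fun w hw => ?_
    obtain ⟨z, hz, hzx, hzw⟩ : ∃ z ∈ A, z ≠ x ∧ z ≠ w := by
      by_contra! hcon
      have h1 := hcon a ha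
      have h2 := hcon b hb
      have h3 := hcon c hcA
      grind
    exact (hh.forces_or_forces hk hA hzw.symm hw hz).resolve_right fun h' =>
      hno x z hzx.symm hf h'
  · right
    push Not at hex
    have hAs : {x | ∃ r s, h s r = x} = A := by
      ext x; exact ⟨fun ⟨r, s, hx⟩ => ⟨s, r, hx⟩, hswap x⟩
    have := eq_left_of_forces (h := fun r s => h s r) fun y hy => by
      rw [hAs]
      obtain ⟨r, s, hy⟩ := hy
      have hyA : y ∈ A := ⟨s, r, hy⟩
      obtain ⟨x, hx, hxy⟩ : ∃ x ∈ A, x ≠ y := by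
        by_contra! hcon
        exact hab ((hcon a ha).trans (hcon b hb).symm)
      exact (hh.forces_or_forces hk hA hxy hx hyA).resolve_left (hex x hx)
    exact fun r r' s => this s r r'

/-! ### Large and small fibres -/

/-- The fibre over `z` of the coordinatewise map given by `u`. -/
noncomputable def fiber {n : ℕ} {R U : Type*} [Fintype R] [DecidableEq U] (u : R → U)
    (z : Fin n → U) :
    Finset (Fin n → R) :=
  {σ | (fun j => u (σ j)) = z}

/-- The indices of the fibres of which `B` misses at most the fraction `γ`. -/
def largeFibers {n : ℕ} {R U : Type*} [Fintype R] [DecidableEq R]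
    [DecidableEq U] (u : R → U) (B : Finset (Fin n → R)) (γ : ℝ) :
    Set (Fin n → U) :=
  {z | (#(fiber u z \ B) : ℝ) ≤ γ * #(fiber u z)}

theorem fiber_eq_piFinset {n : ℕ} {R U : Type*} [Fintype R] [DecidableEq U] (u : R → U)
    (z : Fin n → U) :
    fiber u z = Fintype.piFinset fun j => ({r | u r = z j} : Finset R) := by
  ext σ
  simp [fiber, funext_iff]

theorem card_eq_sum_card_inter_fiber {n : ℕ} {R U : Type*} [Fintype R] [Fintype U] [DecidableEq R]
    [DecidableEq U] (u : R → U)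
    (B : Finset (Fin n → R)) : #B = ∑ z, #(B ∩ fiber u z) := by
  rw [card_eq_sum_card_fiberwise (f := fun σ j => u (σ j)) (t := univ) fun _ _ => by simp]
  refine sum_congr rfl fun z _ => congrArg card ?_
  ext σ
  simp [fiber]

/-- Few points of the large fibres lie outside `B`. -/
theorem card_largeFibers_sdiff_le {n : ℕ} {R U : Type*} [Fintype R] [Fintype U] [DecidableEq R]
    [DecidableEq U] (u : R → U)
    (B : Finset (Fin n → R)) {γ : ℝ} (hγ : 0 ≤ γ) :
    (#{σ : Fin n → R | (fun j => u (σ j)) ∈ largeFibers u B γ ∧ σ ∉ B} : ℝ) ≤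
      γ * Fintype.card (Fin n → R) := by
  rw [card_eq_sum_card_inter_fiber u, ← card_univ, card_eq_sum_card_inter_fiber u univ]
  push_cast
  rw [mul_sum]
  refine sum_le_sum fun z _ => ?_
  rw [univ_inter]
  by_cases hz : z ∈ largeFibers u B γ
  · refine le_trans ?_ (show (#(fiber u z \ B) : ℝ) ≤ γ * #(fiber u z) from hz)
    exact_mod_cast card_le_card fun σ hσ => by
      rw [mem_inter, mem_filter] at hσ
      exact mem_sdiff.2 ⟨hσ.2, hσ.1.2.2⟩
  · refine le_of_eq_of_le ?_ (by positivity : (0 : ℝ) ≤ γ * #(fiber u z))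
    rw [Nat.cast_eq_zero, card_eq_zero, eq_empty_iff_forall_notMem]
    intro σ hσ
    rw [mem_inter, mem_filter, fiber, mem_filter] at hσ
    exact hz (hσ.2.2 ▸ hσ.1.2.1)

/-- Inside the small fibres, the part of `B` has a large boundary. -/
theorem mul_card_smallFibers_le {n : ℕ} {R U : Type*} [Fintype R] [Fintype U] [DecidableEq R]
    [DecidableEq U] (u : R → U)
    (B : Finset (Fin n → R)) (γ : ℝ) :
    γ * #{σ ∈ B | (fun j => u (σ j)) ∉ largeFibers u B γ} ≤
      ∑ j, (#{σ ∈ B | ∃ r, u r = u (σ j) ∧ Function.update σ j r ∉ B} : ℝ) := by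
  have hz : ∀ z, γ * #({σ ∈ B | (fun j => u (σ j)) ∉ largeFibers u B γ} ∩ fiber u z) ≤
      ∑ j, (#({σ ∈ B | ∃ r, u r = u (σ j) ∧ Function.update σ j r ∉ B} ∩ fiber u z) : ℝ) := by
    intro z
    by_cases hz : z ∈ largeFibers u B γ
    · rw [show ({σ ∈ B | (fun j => u (σ j)) ∉ largeFibers u B γ} ∩ fiber u z) = ∅ from ?_]
      · simp only [card_empty, Nat.cast_zero, mul_zero]
        positivity
      · rw [eq_empty_iff_forall_notMem]
        intro σ hσ
        rw [mem_inter, mem_filter, fiber, mem_filter] at hσ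
        exact hσ.1.2 (hσ.2.2.symm ▸ hz)
    have hz' : γ * #(fiber u z) < #(fiber u z \ B) := not_le.1 hz
    rcases (fiber u z).eq_empty_or_nonempty with h0 | h0
    · simp [h0]
    have hpos : (0 : ℝ) < #(fiber u z) := by exact_mod_cast card_pos.2 h0
    have key := card_mul_card_sdiff_le (fun j => ({r | u r = z j} : Finset R)) (B ∩ fiber u z)
      (by rw [← fiber_eq_piFinset]; exact inter_subset_right)
    rw [← fiber_eq_piFinset, sdiff_inter_self_right] at key
    have hsub : ∀ j, #(innerBoundary (fun j => ({r | u r = z j} : Finset R)) (B ∩ fiber u z) j) ≤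
        #({σ ∈ B | ∃ r, u r = u (σ j) ∧ Function.update σ j r ∉ B} ∩ fiber u z) := by
      intro j
      refine card_le_card fun σ hσ => ?_
      obtain ⟨h1, r, h2, h3⟩ := mem_filter.1 hσ
      obtain ⟨h4, h5⟩ := mem_inter.1 h1
      have h6 : ∀ j, u (σ j) = z j := fun j => congrFun (mem_filter.1 h5).2 j
      have h2 : u r = z j := (mem_filter.1 h2).2
      refine mem_inter.2 ⟨mem_filter.2 ⟨h4, r, h2.trans (h6 j).symm, fun h7 => h3 ?_⟩, h5⟩
      refine mem_inter.2 ⟨h7, mem_filter.2 ⟨mem_univ _, ?_⟩⟩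
      ext l
      rcases eq_or_ne l j with rfl | hl
      · simp [h2]
      · simp [hl, h6]
    have key' : (#(B ∩ fiber u z) : ℝ) * #(fiber u z \ B) ≤ #(fiber u z) *
        ∑ j, (#({σ ∈ B | ∃ r, u r = u (σ j) ∧ Function.update σ j r ∉ B} ∩ fiber u z) : ℝ) := by
      exact_mod_cast key.trans (Nat.mul_le_mul_left _ (sum_le_sum fun j _ => hsub j))
    have hle : (#({σ ∈ B | (fun j => u (σ j)) ∉ largeFibers u B γ} ∩ fiber u z) : ℝ) ≤
        #(B ∩ fiber u z) := by
      exact_mod_cast card_le_card (inter_subset_inter_right (filter_subset _ _))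
    rcases lt_or_ge γ 0 with hγ | hγ
    · exact le_trans (mul_nonpos_of_nonpos_of_nonneg hγ.le (Nat.cast_nonneg _))
        (sum_nonneg fun _ _ => Nat.cast_nonneg _)
    refine le_of_mul_le_mul_left (le_trans ?_ key') hpos
    have := mul_le_mul_of_nonneg_left hz'.le (Nat.cast_nonneg (α := ℝ) #(B ∩ fiber u z))
    have := mul_le_mul_of_nonneg_left hle (mul_nonneg hγ hpos.le)
    linarith
  rw [card_eq_sum_card_inter_fiber u]
  have h2 := fun j => card_eq_sum_card_inter_fiber u
    {σ ∈ B | ∃ r, u r = u (σ j) ∧ Function.update σ j r ∉ B}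
  simp only [h2]
  push_cast
  rw [mul_sum, sum_comm]
  exact sum_le_sum fun z _ => hz z

/-! ### Boundaries of a social choice function and nearby manipulation points -/

variable {n k : ℕ}

/-- The profiles with outcome `a` at which voter `i` can change the outcome to `b`. -/
noncomputable def boundary (f : SCF n k) (i : Fin n) (a b : Fin k) : Finset (Profile n k) :=
  {σ | f σ = a ∧ ∃ r, f (Function.update σ i r) = b}

/-- The profiles that become a manipulation point when voters `i` and `j` change their rankings
suitably. -/
noncomputable def nearManipulation (f : SCF n k) (i j : Fin n) : Finset (Profile n k) :=
  {σ | ∃ r s, Function.update (Function.update σ i r) j s ∈ manipulationPoints f}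

/-- The outcome as a function of the ranking of voter `i`, the other rankings being those
of `σ`. -/
def line (f : SCF n k) (i : Fin n) (σ : Profile n k) (r : Ranking k) : Fin k :=
  f (Function.update σ i r)

/-- The function `g` takes the values `a` and `b` and a third value. -/
def TakesThirdValue (a b : Fin k) (g : Ranking k → Fin k) : Prop :=
  (∃ r, g r = a) ∧ (∃ r, g r = b) ∧ ∃ r, g r ≠ a ∧ g r ≠ b

theorem card_ranking : Fintype.card (Ranking k) = k.factorial := by
  simp [Fintype.card_perm]

theorem card_nearManipulation_le (f : SCF n k) (i j : Fin n) :
    #(nearManipulation f i j) ≤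
      k.factorial ^ 2 * #{σ : Profile n k | σ ∈ manipulationPoints f} := by
  calc #(nearManipulation f i j)
      ≤ #((({σ : Profile n k | σ ∈ manipulationPoints f} : Finset _) ×ˢ
          (univ : Finset (Ranking k × Ranking k))).image
          fun p => Function.update (Function.update p.1 i p.2.1) j p.2.2) := by
        refine card_le_card fun σ hσ => ?_
        obtain ⟨r, s, h⟩ := (mem_filter.1 hσ).2
        refine mem_image.2 ⟨(_, (σ i, σ j)), mem_product.2
          ⟨mem_filter.2 ⟨mem_univ _, h⟩, mem_univ _⟩, ?_⟩
        ext1 l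
        by_cases hj : l = j
        · subst hj; simp
        by_cases hi : l = i
        · subst hi; simp [hj]
        · change Function.update (Function.update (Function.update (Function.update σ i r) j s)
            i (σ i)) j (σ j) l = σ l
          rw [Function.update_of_ne hj, Function.update_of_ne hi, Function.update_of_ne hj,
            Function.update_of_ne hi]
    _ ≤ _ := card_image_le
    _ = _ := by
      rw [card_product, card_univ, Fintype.card_prod, card_ranking]; ring

theorem update_update_apply_right {i j : Fin n} (hij : j ≠ i) (σ : Profile n k) (r : Ranking k) :
    Function.update (Function.update σ i r) j (σ j) = Function.update σ i r := by
  rw [Function.update_eq_self_iff, Function.update_of_ne hij]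

theorem update_update_apply_left {i j : Fin n} (σ : Profile n k) (s : Ranking k) :
    Function.update (Function.update σ i (σ i)) j s = Function.update σ j s := by
  rw [Function.update_eq_self]

theorem isStrategyproof_of_notMem_nearManipulation {f : SCF n k} {i j : Fin n} (hij : j ≠ i)
    {σ : Profile n k} (hσ : σ ∉ nearManipulation f i j) :
    IsStrategyproof fun r s => f (Function.update (Function.update σ i r) j s) := by
  have h : ∀ r s, Function.update (Function.update σ i r) j s ∉ manipulationPoints f := by
    intro r s h
    exact hσ (mem_filter.2 ⟨mem_univ _, r, s, h⟩)
  constructor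
  · intro r s r' hp
    refine h r s ⟨Function.update (Function.update σ i r') j s, i, fun l hl => ?_, ?_⟩
    · by_cases hj : l = j
      · subst hj; simp
      · simp [hl, hj]
    · rw [Function.update_of_ne hij.symm, Function.update_self]
      exact hp
  · intro r s s' hp
    refine h r s ⟨Function.update (Function.update σ i r) j s', j, fun l hl => ?_, ?_⟩
    · simp [hl]
    · rw [Function.update_self]
      exact hp

/-- Leaving the boundary through a change of the ranking of another voter `j` that keeps the order
of `a` and `b` is possible only near a manipulation point. -/
theorem mem_nearManipulation_of_leave {f : SCF n k} (hk : 3 ≤ k) {i j : Fin n} (hij : j ≠ i)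
    {a b : Fin k} (hab : a ≠ b) {σ : Profile n k} (hσ : σ ∈ boundary f i a b) {s : Ranking k}
    (hs : comparison a b s = comparison a b (σ j))
    (hσ' : Function.update σ j s ∉ boundary f i a b) : σ ∈ nearManipulation f i j := by
  by_contra hnear
  have hsp := isStrategyproof_of_notMem_nearManipulation hij hnear
  obtain ⟨ha, r, hb⟩ := (mem_filter.1 hσ).2
  set h : Ranking k → Ranking k → Fin k :=
    fun r s => f (Function.update (Function.update σ i r) j s) with hdef
  have ha' : h (σ i) (σ j) = a := by simp [hdef, ha]
  have hb' : h r (σ j) = b := by simp only [hdef]; rw [update_update_apply_right hij, hb]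
  have hnot : ¬ (h (σ i) s = a ∧ h r s = b) := by
    rintro ⟨h1, h2⟩
    refine hσ' (mem_filter.2 ⟨mem_univ _, ?_, r, ?_⟩)
    · simpa only [hdef, update_update_apply_left] using h1
    · rw [Function.update_comm hij]; exact h2
  have hs : Prefers s a b ↔ Prefers (σ j) a b := decide_eq_decide.1 hs
  -- voter `j` cannot switch between `a` and `b` without changing their order
  have hst : ∀ t, ¬ (h t (σ j) = a ∧ h t s = b) ∧ ¬ (h t (σ j) = b ∧ h t s = a) := by
    intro t
    have h1 := hsp.2 t (σ j) s
    have h2 := hsp.2 t s (σ j)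
    have hor := prefers_or_prefers (σ j) hab
    have hor' := prefers_or_prefers s hab
    constructor
    · rintro ⟨h3, h4⟩
      rw [h3, h4] at h1 h2
      exact h2 (hs.2 (hor.resolve_right h1))
    · rintro ⟨h3, h4⟩
      rw [h3, h4] at h1 h2
      exact h1 (hs.1 (hor'.resolve_right h2))
  by_cases hc : ∃ r s, h r s ≠ a ∧ h r s ≠ b
  · rcases hsp.eq_left_or_eq_right hk hab ⟨_, _, ha'⟩ ⟨_, _, hb'⟩ hc with h1 | h1
    · exact hnot ⟨(h1 _ _ _).trans ha', (h1 _ _ _).trans hb'⟩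
    · exact hab (ha'.symm.trans ((h1 _ _ _).trans hb'))
  · push Not at hc
    have h1 : h (σ i) s = a := by
      by_contra h1
      exact (hst (σ i)).1 ⟨ha', hc _ _ h1⟩
    have h2 : h r s = b := by
      by_contra h2
      refine (hst r).2 ⟨hb', ?_⟩
      by_contra h3
      exact h2 (hc _ _ h3)
    exact hnot ⟨h1, h2⟩

/-- Leaving the boundary through a change of the ranking of voter `i` that keeps the order of `a`
and `b` is possible only if voter `i` can manipulate or can choose between three alternatives. -/
theorem mem_nearManipulation_or_takesThirdValue_of_leave {f : SCF n k} {i : Fin n}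
    {a b : Fin k} (hab : a ≠ b) {σ : Profile n k} (hσ : σ ∈ boundary f i a b) {s : Ranking k}
    (hs : comparison a b s = comparison a b (σ i))
    (hσ' : Function.update σ i s ∉ boundary f i a b) :
    σ ∈ nearManipulation f i i ∨ TakesThirdValue a b (line f i σ) := by
  obtain ⟨ha, r, hb⟩ := (mem_filter.1 hσ).2
  have hs : Prefers s a b ↔ Prefers (σ i) a b := decide_eq_decide.1 hs
  have hne : f (Function.update σ i s) ≠ a := by
    intro h
    exact hσ' (mem_filter.2 ⟨mem_univ _, h, r, by simpa using hb⟩)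
  by_cases hsb : f (Function.update σ i s) = b
  · left
    rcases prefers_or_prefers (σ i) hab with h | h
    · refine mem_filter.2 ⟨mem_univ _, s, s, σ, i, fun l hl => by simp [hl], ?_⟩
      simpa [hsb, ha] using hs.2 h
    · refine mem_filter.2 ⟨mem_univ _, s, σ i, Function.update σ i s, i,
        fun l hl => by simp [hl], ?_⟩
      simpa [hsb, ha] using h
  · exact Or.inr ⟨⟨σ i, by simp [line, ha]⟩, ⟨r, hb⟩, s, hne, hsb⟩

/-- If voter `i` can choose between three alternatives, then the influence of another voter on this
choice causes a manipulation point. -/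
theorem mem_nearManipulation_of_line_ne {f : SCF n k} (hk : 3 ≤ k) {i j : Fin n}
    {a b : Fin k} (hab : a ≠ b) {σ : Profile n k} (hσ : TakesThirdValue a b (line f i σ))
    {s : Ranking k} (hs : line f i (Function.update σ j s) ≠ line f i σ) :
    σ ∈ nearManipulation f i j := by
  rcases eq_or_ne j i with rfl | hij
  · refine absurd ?_ hs
    ext r
    simp [line]
  by_contra hnear
  have hsp := isStrategyproof_of_notMem_nearManipulation hij hnear
  set h : Ranking k → Ranking k → Fin k :=
    fun r s => f (Function.update (Function.update σ i r) j s) with hdef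
  have hline : ∀ r, line f i σ r = h r (σ j) := by
    intro r
    simp only [hdef]
    rw [update_update_apply_right hij, line]
  obtain ⟨⟨r₁, h₁⟩, ⟨r₂, h₂⟩, ⟨r₃, h₃⟩⟩ := hσ
  rw [hline] at h₁ h₂ h₃
  rcases hsp.eq_left_or_eq_right hk hab ⟨_, _, h₁⟩ ⟨_, _, h₂⟩ ⟨_, _, h₃⟩ with h' | h'
  · refine hs (funext fun r => ?_)
    rw [hline, line, Function.update_comm hij]
    exact h' _ _ _
  · exact hab (h₁.symm.trans ((h' _ _ _).trans h₂))

/-! ### Distance from the nonmanipulable functions -/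

theorem uniformProb_eq {α : Type*} [Fintype α] (P : α → Prop) [DecidablePred P] :
    uniformProb P = #{x | P x} / (Fintype.card α : ℝ) := by
  rw [uniformProb, Nat.card_eq_fintype_card, Fintype.card_subtype]

theorem uniformProb_nonneg {α : Type*} [Fintype α] (P : α → Prop) : 0 ≤ uniformProb P := by
  unfold uniformProb; positivity

theorem card_profile_pos : (0 : ℝ) < Fintype.card (Profile n k) := by
  exact_mod_cast Fintype.card_pos

theorem mul_card_le_of_mem_nonmanipBar {f g : SCF n k} {ε : ℝ}
    (hε : ε ≤ distToClass f (nonmanipBar n k)) (hg : g ∈ nonmanipBar n k) :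
    ε * Fintype.card (Profile n k) ≤ #{σ | f σ ≠ g σ} := by
  rw [← le_div_iff₀ card_profile_pos, ← uniformProb_eq]
  refine hε.trans (csInf_le ⟨0, ?_⟩ ⟨g, hg, rfl⟩)
  rintro _ ⟨g, -, rfl⟩
  exact uniformProb_nonneg _

/-- A function far from those with at most two values takes values other than `a` and `b` often. -/
theorem mul_card_le_card_ne_ne {f : SCF n k} {ε : ℝ}
    (hε : ε ≤ distToClass f (nonmanipBar n k)) (a b : Fin k) :
    ε * Fintype.card (Profile n k) ≤ #{σ | f σ ≠ a ∧ f σ ≠ b} := by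
  have hg : (fun σ => if f σ = b then b else a) ∈ nonmanipBar n k := by
    right
    refine (Set.ncard_le_ncard (t := {a, b}) ?_ (Set.toFinite _)).trans
      ((Set.ncard_insert_le _ _).trans (by simp))
    rintro _ ⟨σ, rfl⟩
    dsimp only
    split_ifs <;> simp
  refine (mul_card_le_of_mem_nonmanipBar hε hg).trans ?_
  refine Nat.cast_le.2 (card_le_card fun σ hσ => ?_)
  have h := (mem_filter.1 hσ).2
  refine mem_filter.2 ⟨mem_univ _, ?_⟩
  split_ifs at h with h1
  · exact absurd h1 h
  · exact ⟨h, h1⟩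

/-- Some alternative other than `a` and `b` has a large boundary. -/
theorem exists_large_boundary {f : SCF n k} {ε : ℝ} (hε0 : 0 < ε)
    (hε : ε ≤ distToClass f (nonmanipBar n k)) (a b : Fin k) :
    ∃ (c d : Fin k) (i : Fin n), c ≠ a ∧ c ≠ b ∧ c ≠ d ∧
      ε / (2 * n * k ^ 2) * Fintype.card (Profile n k) ≤ #(boundary f i c d) := by
  set N : ℝ := (Fintype.card (Profile n k) : ℝ) with hN
  have hN0 : 0 < N := card_profile_pos
  have hk0 : (0 : ℝ) < k := by exact_mod_cast a.pos
  have hε1 : ε * N ≤ N := (mul_card_le_card_ne_ne hε a b).trans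
    (Nat.cast_le.2 (card_le_univ _))
  set p : Fin k → Finset (Profile n k) := fun c => {σ | f σ = c} with hp
  obtain ⟨c, hca, hcb, hc⟩ : ∃ c, c ≠ a ∧ c ≠ b ∧ ε * N / k ≤ #(p c) := by
    by_contra! hcon
    have h1 : (#{σ | f σ ≠ a ∧ f σ ≠ b} : ℝ) = ∑ c ∈ {c | c ≠ a ∧ c ≠ b}, (#(p c) : ℝ) := by
      rw [card_eq_sum_card_fiberwise (f := f) (t := {c | c ≠ a ∧ c ≠ b})
        fun σ hσ => by simpa using hσ]
      push_cast
      refine sum_congr rfl fun c hc => ?_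
      congr 2
      ext σ
      simp only [mem_filter, mem_univ, true_and] at hc
      simp only [hp, mem_filter, mem_univ, true_and, and_iff_right_iff_imp]
      rintro rfl
      exact hc
    have h2 := mul_card_le_card_ne_ne hε a b
    rw [h1] at h2
    have hne : (({c | c ≠ a ∧ c ≠ b} : Finset (Fin k))).Nonempty := by
      by_contra hemp
      rw [not_nonempty_iff_eq_empty] at hemp
      rw [hemp, sum_empty] at h2
      have := mul_pos hε0 hN0
      linarith
    have h3 : ∑ c ∈ {c | c ≠ a ∧ c ≠ b}, (#(p c) : ℝ) < ∑ c ∈ {c | c ≠ a ∧ c ≠ b}, ε * N / k :=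
      sum_lt_sum_of_nonempty hne fun c hc => by
        have hc := (mem_filter.1 hc).2
        exact hcon c hc.1 hc.2
    rw [sum_const, nsmul_eq_mul] at h3
    have h4 : (#({c | c ≠ a ∧ c ≠ b} : Finset (Fin k)) : ℝ) ≤ k := by
      exact_mod_cast (card_le_univ _).trans_eq (Fintype.card_fin k)
    have h5 : (#({c | c ≠ a ∧ c ≠ b} : Finset (Fin k)) : ℝ) * (ε * N / k) ≤ k * (ε * N / k) := by
      gcongr
    rw [mul_div_cancel₀ _ hk0.ne'] at h5
    linarith
  have hcompl : ε * N ≤ #(univ \ p c) := by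
    refine (mul_card_le_card_ne_ne hε c c).trans (Nat.cast_le.2 (card_le_card fun σ hσ => ?_))
    have := (mem_filter.1 hσ).2.1
    simpa [hp] using this
  have hsum : (#(p c) : ℝ) + #(univ \ p c) = N := by
    have := card_sdiff_add_card_eq_card (subset_univ (p c))
    rw [card_univ] at this
    rw [hN, ← this]
    push_cast
    ring
  have hk1 : (1 : ℝ) ≤ k := by exact_mod_cast a.pos
  have hdiv : ε * N / k ≤ ε * N := div_le_self (by positivity) hk1
  have hprod : N * (ε * N / (2 * k)) ≤ #(p c) * #(univ \ p c) := by
    have e : N * (ε * N / (2 * k)) = (N / 2) * (ε * N / k) := by ring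
    rw [e]
    rcases le_total (#(p c) : ℝ) (N / 2) with h | h
    · rw [mul_comm]
      exact mul_le_mul hc (by linarith) (by positivity) (by positivity)
    · exact mul_le_mul h (hdiv.trans hcompl) (by positivity) (by positivity)
  have hiso := card_mul_card_sdiff_le (fun _ : Fin n => (univ : Finset (Ranking k))) (p c)
    (by simp)
  rw [Fintype.piFinset_univ, card_univ] at hiso
  have hsub : ∀ i, innerBoundary (fun _ : Fin n => (univ : Finset (Ranking k))) (p c) i ⊆
      (univ.erase c).biUnion fun d => boundary f i c d := by
    intro i σ hσ
    obtain ⟨h1, r, -, h2⟩ := mem_filter.1 hσ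
    have h1 : f σ = c := (mem_filter.1 h1).2
    refine mem_biUnion.2 ⟨f (Function.update σ i r), mem_erase.2 ⟨fun h => h2 ?_, mem_univ _⟩,
      mem_filter.2 ⟨mem_univ _, h1, r, rfl⟩⟩
    exact mem_filter.2 ⟨mem_univ _, h⟩
  by_contra! hcon
  have hn : (univ : Finset (Fin n)).Nonempty := by
    by_contra hemp
    rw [not_nonempty_iff_eq_empty] at hemp
    rw [hemp, sum_empty, mul_zero] at hiso
    have h0 : (#(p c) : ℝ) * #(univ \ p c) ≤ 0 := by exact_mod_cast hiso
    have : 0 < N * (ε * N / (2 * k)) := by positivity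
    linarith
  have hn0 : (0 : ℝ) < n := by
    have := card_pos.2 hn
    rw [card_fin] at this
    exact_mod_cast this
  have hlt : ∀ i, (#(innerBoundary (fun _ : Fin n => (univ : Finset (Ranking k))) (p c) i) : ℝ) <
      k * (ε / (2 * n * k ^ 2) * N) := by
    intro i
    calc (#(innerBoundary (fun _ : Fin n => (univ : Finset (Ranking k))) (p c) i) : ℝ)
        ≤ ∑ d ∈ univ.erase c, (#(boundary f i c d) : ℝ) := by
          exact_mod_cast (card_le_card (hsub i)).trans card_biUnion_le
      _ ≤ ∑ d ∈ univ.erase c, (ε / (2 * n * k ^ 2) * N) :=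
          sum_le_sum fun d hd => (hcon c d i hca hcb (ne_of_mem_erase hd).symm).le
      _ = (k - 1) * (ε / (2 * n * k ^ 2) * N) := by
          rw [sum_const, nsmul_eq_mul, card_erase_of_mem (mem_univ _), card_fin,
            Nat.cast_sub a.pos]
          simp
      _ < _ := by gcongr; linarith
  have htot : (∑ i, #(innerBoundary (fun _ : Fin n => (univ : Finset (Ranking k))) (p c) i) : ℝ) <
      ε * N / (2 * k) := by
    refine (sum_lt_sum_of_nonempty hn fun i _ => hlt i).trans_eq ?_
    rw [sum_const, nsmul_eq_mul, card_fin]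
    field_simp
  have hiso' : (#(p c) : ℝ) * #(univ \ p c) ≤ N *
      ∑ i, (#(innerBoundary (fun _ : Fin n => (univ : Finset (Ranking k))) (p c) i) : ℝ) := by
    rw [hN]
    exact_mod_cast hiso
  have := mul_lt_mul_of_pos_left htot hN0
  linarith

/-! ### Counting manipulation points -/

/-- Voter `i` can choose between three alternatives only near manipulation points, up to a factor
`ε`: as `f` is `ε`-far from depending on voter `i` alone, the sets of profiles with a given function
of voter `i` have a boundary, and this boundary is near manipulation points. -/
theorem mul_card_takesThirdValue_le {f : SCF n k} {ε : ℝ} (hk : 3 ≤ k)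
    (hε : ε ≤ distToClass f (nonmanipBar n k)) (i : Fin n) {a b : Fin k} (hab : a ≠ b) :
    ε * #{σ | TakesThirdValue a b (line f i σ)} ≤
      ∑ j, (#(nearManipulation f i j) : ℝ) := by
  have hN0 : (0 : ℝ) < Fintype.card (Profile n k) := card_profile_pos
  have hg : ∀ g : Ranking k → Fin k,
      ε * #{σ ∈ ({σ | TakesThirdValue a b (line f i σ)} : Finset _) | line f i σ = g} ≤
        ∑ j, (#{σ ∈ nearManipulation f i j | line f i σ = g} : ℝ) := by
    intro g
    by_cases hg : TakesThirdValue a b g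
    swap
    · rw [show ({σ ∈ ({σ | TakesThirdValue a b (line f i σ)} : Finset (Profile n k)) |
        line f i σ = g} : Finset _) = ∅ from ?_]
      · simp only [card_empty, Nat.cast_zero, mul_zero]
        positivity
      · rw [filter_eq_empty_iff]
        intro σ hσ h
        exact hg (h ▸ (mem_filter.1 hσ).2)
    set A : Finset (Profile n k) := {σ | line f i σ = g} with hA
    have hAeq : ({σ ∈ ({σ | TakesThirdValue a b (line f i σ)} : Finset (Profile n k)) |
        line f i σ = g} : Finset _) = A := by
      ext σ
      simp only [hA, mem_filter, mem_univ, true_and, and_iff_right_iff_imp]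
      rintro h
      exact h ▸ hg
    rw [hAeq]
    have hiso := card_mul_card_sdiff_le (fun _ : Fin n => (univ : Finset (Ranking k))) A (by simp)
    rw [Fintype.piFinset_univ, card_univ] at hiso
    have hfar : ε * Fintype.card (Profile n k) ≤ #(univ \ A) := by
      refine (mul_card_le_of_mem_nonmanipBar hε (g := fun σ => g (σ i))
        (Or.inl ⟨i, g, fun _ => rfl⟩)).trans (Nat.cast_le.2 (card_le_card fun σ hσ => ?_))
      refine mem_sdiff.2 ⟨mem_univ _, fun h => (mem_filter.1 hσ).2 ?_⟩
      rw [← (mem_filter.1 h).2, line, Function.update_eq_self]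
    have hsub : ∀ j, #(innerBoundary (fun _ : Fin n => (univ : Finset (Ranking k))) A j) ≤
        #{σ ∈ nearManipulation f i j | line f i σ = g} := by
      intro j
      refine card_le_card fun σ hσ => ?_
      obtain ⟨h1, s, -, h2⟩ := mem_filter.1 hσ
      have h1 : line f i σ = g := (mem_filter.1 h1).2
      refine mem_filter.2 ⟨mem_nearManipulation_of_line_ne hk hab (h1 ▸ hg) (s := s) fun h => h2 ?_,
        h1⟩
      exact mem_filter.2 ⟨mem_univ _, h.trans h1⟩
    have hiso' : (#A : ℝ) * #(univ \ A) ≤ Fintype.card (Profile n k) *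
        ∑ j, (#{σ ∈ nearManipulation f i j | line f i σ = g} : ℝ) := by
      exact_mod_cast hiso.trans (Nat.mul_le_mul_left _ (sum_le_sum fun j _ => hsub j))
    refine le_of_mul_le_mul_left (le_trans ?_ hiso') hN0
    have := mul_le_mul_of_nonneg_left hfar (Nat.cast_nonneg (α := ℝ) #A)
    linarith
  rw [card_eq_sum_card_fiberwise (f := line f i) (t := univ) fun _ _ => by simp]
  have h2 := fun j => card_eq_sum_card_fiberwise (s := nearManipulation f i j) (f := line f i)
    (t := univ) fun _ _ => by simp
  simp only [h2]
  push_cast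
  rw [mul_sum, sum_comm]
  exact sum_le_sum fun g _ => hg g

theorem sum_card_nearManipulation_le (f : SCF n k) (i : Fin n) :
    ∑ j, (#(nearManipulation f i j) : ℝ) ≤
      n * (k.factorial ^ 2 * #{σ : Profile n k | σ ∈ manipulationPoints f}) := by
  calc ∑ j, (#(nearManipulation f i j) : ℝ)
      ≤ ∑ _j : Fin n, (k.factorial ^ 2 * #{σ : Profile n k | σ ∈ manipulationPoints f} : ℝ) :=
        sum_le_sum fun j _ => by exact_mod_cast card_nearManipulation_le f i j
    _ = _ := by simp

/-- The part of a boundary in small fibres bounds the number of manipulation points from below. -/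
theorem mul_card_smallFibers_le_card_manipulationPoints {f : SCF n k} {ε : ℝ} (hk : 3 ≤ k)
    (hε0 : 0 < ε) (hε : ε ≤ distToClass f (nonmanipBar n k)) (i : Fin n) {a b : Fin k}
    (hab : a ≠ b) (γ : ℝ) :
    ε * (γ * #{σ ∈ boundary f i a b |
        (fun j => comparison a b (σ j)) ∉ largeFibers (comparison a b) (boundary f i a b) γ}) ≤
      2 * n * k.factorial ^ 2 * #{σ : Profile n k | σ ∈ manipulationPoints f} := by
  set W : Finset (Profile n k) := {σ | TakesThirdValue a b (line f i σ)} with hW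
  set B := boundary f i a b with hB
  have hN0 : (0 : ℝ) < Fintype.card (Profile n k) := card_profile_pos
  have hε1 : ε ≤ 1 := by
    have : ε * Fintype.card (Profile n k) ≤ Fintype.card (Profile n k) :=
      (mul_card_le_card_ne_ne hε a b).trans (Nat.cast_le.2 (card_le_univ _))
    exact le_of_mul_le_mul_right (by linarith) hN0
  have h1 := mul_card_smallFibers_le (comparison a b) B γ
  have h2 : ∀ j, (#{σ ∈ B | ∃ r, comparison a b r = comparison a b (σ j) ∧
      Function.update σ j r ∉ B} : ℝ) ≤
      #(nearManipulation f i j) + if j = i then (#W : ℝ) else 0 := by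
    intro j
    split_ifs with hj
    · subst hj
      rw [← Nat.cast_add]
      refine Nat.cast_le.2 ((card_le_card fun σ hσ => ?_).trans (card_union_le _ _))
      obtain ⟨h3, r, h4, h5⟩ := mem_filter.1 hσ
      rcases mem_nearManipulation_or_takesThirdValue_of_leave hab h3 h4 h5 with h | h
      · exact mem_union_left _ h
      · exact mem_union_right _ (mem_filter.2 ⟨mem_univ _, h⟩)
    · rw [add_zero]
      refine Nat.cast_le.2 (card_le_card fun σ hσ => ?_)
      obtain ⟨h3, r, h4, h5⟩ := mem_filter.1 hσ
      exact mem_nearManipulation_of_leave hk hj hab h3 h4 h5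
  have h3 := h1.trans (sum_le_sum fun j _ => h2 j)
  rw [sum_add_distrib, sum_ite_eq' univ i, if_pos (mem_univ _)] at h3
  have h4 := mul_le_mul_of_nonneg_left h3 hε0.le
  have h5 := mul_card_takesThirdValue_le hk hε i hab
  have h6 := sum_card_nearManipulation_le f i
  have h7 : ε * ∑ j, (#(nearManipulation f i j) : ℝ) ≤ ∑ j, (#(nearManipulation f i j) : ℝ) :=
    mul_le_of_le_one_left (sum_nonneg fun _ _ => Nat.cast_nonneg _) hε1
  rw [mul_add] at h4
  linarith

theorem card_filter_mem_add_card_filter_notMem {α : Type*} (B : Finset α) (P : α → Prop) :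
    (#B : ℝ) = #{x ∈ B | P x} + #{x ∈ B | ¬ P x} := by
  exact_mod_cast (card_filter_add_card_filter_not P).symm

/-- Boundaries for two different pairs cannot both lie mostly in large fibres: by reverse
hypercontractivity many profiles are in large fibres for both pairs, and most of them would have
both the outcome `a` and the outcome `c`. -/
theorem card_largeFibers_lt_or_lt {f : SCF n k} {i j : Fin n} {a b c d : Fin k} (hab : a ≠ b)
    (hcd : c ≠ d) (hca : c ≠ a) (hcb : c ≠ b) {δ : ℝ} (hδ : 0 < δ) :
    (#{σ ∈ boundary f i a b | (fun l => comparison a b (σ l)) ∈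
        largeFibers (comparison a b) (boundary f i a b) (δ ^ 3 / 4)} : ℝ) <
      δ * Fintype.card (Profile n k) ∨
    (#{σ ∈ boundary f j c d | (fun l => comparison c d (σ l)) ∈
        largeFibers (comparison c d) (boundary f j c d) (δ ^ 3 / 4)} : ℝ) <
      δ * Fintype.card (Profile n k) := by
  by_contra! hcon
  obtain ⟨h1, h2⟩ := hcon
  have hN0 : (0 : ℝ) < Fintype.card (Profile n k) := card_profile_pos
  set X := largeFibers (comparison a b) (boundary f i a b) (δ ^ 3 / 4)
  set Y := largeFibers (comparison c d) (boundary f j c d) (δ ^ 3 / 4)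
  have key := ((reverseHypercontractive_comparison hab hcd hca hcb).pi n).cube_mul_card_le X Y hδ.le
    (h1.trans (Nat.cast_le.2 (card_le_card (filter_subset_filter _ (subset_univ _)))))
    (h2.trans (Nat.cast_le.2 (card_le_card (filter_subset_filter _ (subset_univ _)))))
  have h3 := card_largeFibers_sdiff_le (comparison a b) (boundary f i a b) (γ := δ ^ 3 / 4)
    (by positivity)
  have h4 := card_largeFibers_sdiff_le (comparison c d) (boundary f j c d) (γ := δ ^ 3 / 4)
    (by positivity)
  have h5 : (#{σ : Profile n k | (fun l => comparison a b (σ l)) ∈ X ∧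
      (fun l => comparison c d (σ l)) ∈ Y} : ℝ) ≤
      #{σ : Profile n k | (fun l => comparison a b (σ l)) ∈ X ∧ σ ∉ boundary f i a b} +
      #{σ : Profile n k | (fun l => comparison c d (σ l)) ∈ Y ∧ σ ∉ boundary f j c d} := by
    rw [← Nat.cast_add]
    refine Nat.cast_le.2 ((card_le_card fun σ hσ => ?_).trans (card_union_le _ _))
    obtain ⟨hX, hY⟩ := (mem_filter.1 hσ).2
    by_cases hB : σ ∈ boundary f i a b
    · refine mem_union_right _ (mem_filter.2 ⟨mem_univ _, hY, fun hB' => hca ?_⟩)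
      exact (mem_filter.1 hB').2.1.symm.trans (mem_filter.1 hB).2.1
    · exact mem_union_left _ (mem_filter.2 ⟨mem_univ _, hX, hB⟩)
  have := mul_pos (pow_pos hδ 3) hN0
  linarith

theorem pow_div_le_manipulationProb (hn : 2 ≤ n) (hk : 3 ≤ k) (f : SCF n k) (ε : ℝ)
    (hε : ε ≤ distToClass f (nonmanipBar n k)) :
    ε ^ 5 / (4 * (n : ℝ) ^ 7 * (k : ℝ) ^ 12 * (k.factorial : ℝ) ^ 4) ≤ manipulationProb f := by
  rcases le_or_gt ε 0 with hε0 | hε0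
  · refine le_trans (div_nonpos_of_nonpos_of_nonneg ?_ (by positivity)) (uniformProb_nonneg _)
    exact Odd.pow_nonpos (by decide) hε0
  set N : ℝ := (Fintype.card (Profile n k) : ℝ) with hN
  have hN0 : 0 < N := card_profile_pos
  have hn2 : (2 : ℝ) ≤ n := by exact_mod_cast hn
  have hk3 : (3 : ℝ) ≤ k := by exact_mod_cast hk
  have hk6 : (6 : ℝ) ≤ k.factorial := by
    exact_mod_cast (show 6 = Nat.factorial 3 from rfl) ▸ Nat.factorial_le hk
  have hn0 : (0 : ℝ) < n := by linarith
  have hk0 : (0 : ℝ) < k := by linarith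
  have hf0 : (0 : ℝ) < k.factorial := by linarith
  obtain ⟨a, b, i, -, -, hab, hi⟩ := exists_large_boundary hε0 hε (⟨0, by omega⟩) ⟨0, by omega⟩
  obtain ⟨c, d, j, hca, hcb, hcd, hj⟩ := exists_large_boundary hε0 hε a b
  set m : ℝ := (#{σ : Profile n k | σ ∈ manipulationPoints f} : ℝ) with hm
  -- `2 * δ` is the density of the two boundaries: at least half of one is in small fibres
  set δ : ℝ := ε / (4 * n * k ^ 2) with hδ
  have hδ0 : 0 < δ := by positivity
  have h2δ : ε / (2 * n * k ^ 2) = 2 * δ := by rw [hδ]; field_simp; norm_num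
  rw [h2δ, ← hN] at hi hj
  have main : ε * (δ ^ 3 / 4 * (δ * N)) ≤ 2 * n * k.factorial ^ 2 * m := by
    rcases card_largeFibers_lt_or_lt (f := f) (i := i) (j := j) hab hcd hca hcb hδ0 with h | h
    · refine le_trans ?_
        (mul_card_smallFibers_le_card_manipulationPoints hk hε0 hε i hab (δ ^ 3 / 4))
      rw [card_filter_mem_add_card_filter_notMem _ (fun σ : Profile n k =>
        (fun l => comparison a b (σ l)) ∈
          largeFibers (comparison a b) (boundary f i a b) (δ ^ 3 / 4))] at hi
      gcongr
      linarith
    · refine le_trans ?_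
        (mul_card_smallFibers_le_card_manipulationPoints hk hε0 hε j hcd (δ ^ 3 / 4))
      rw [card_filter_mem_add_card_filter_notMem _ (fun σ : Profile n k =>
        (fun l => comparison c d (σ l)) ∈
          largeFibers (comparison c d) (boundary f j c d) (δ ^ 3 / 4))] at hj
      gcongr
      linarith
  have hlow : ε * δ ^ 4 / (8 * n * k.factorial ^ 2) ≤ m / N := by
    rw [div_le_div_iff₀ (by positivity) hN0]
    linarith
  rw [manipulationProb, uniformProb_eq]
  refine le_trans ?_ hlow
  have e : ε * δ ^ 4 / (8 * n * k.factorial ^ 2) =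
      ε ^ 5 / (2048 * n ^ 5 * k ^ 8 * k.factorial ^ 2) := by
    rw [hδ]; field_simp; norm_num
  rw [e]
  refine div_le_div_of_nonneg_left (by positivity) (by positivity) ?_
  have h1 : (512 : ℝ) ≤ n ^ 2 * k ^ 4 * k.factorial ^ 2 := by
    calc (512 : ℝ) ≤ 2 ^ 2 * 3 ^ 4 * 6 ^ 2 := by norm_num
      _ ≤ _ := by gcongr
  calc (2048 * n ^ 5 * k ^ 8 * k.factorial ^ 2 : ℝ)
      = 4 * n ^ 5 * k ^ 8 * k.factorial ^ 2 * 512 := by ring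
    _ ≤ 4 * n ^ 5 * k ^ 8 * k.factorial ^ 2 * (n ^ 2 * k ^ 4 * k.factorial ^ 2) := by gcongr
    _ = _ := by ring

/-- From a manipulation point, the random voter and ranking have probability at least `1/(n k!)` of
giving a manipulation pair. -/
theorem manipulationProb_div_le_randomManipulationProb (f : SCF n k) :
    manipulationProb f / (n * k.factorial) ≤ randomManipulationProb f := by
  rw [manipulationProb, randomManipulationProb, uniformProb_eq, uniformProb_eq, div_div]
  have hcard : (Fintype.card (Profile n k × Fin n × Ranking k) : ℝ) =
      Fintype.card (Profile n k) * (n * k.factorial) := by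
    rw [Fintype.card_prod, Fintype.card_prod, card_ranking, Fintype.card_fin]
    push_cast
    ring
  rw [hcard]
  refine div_le_div_of_nonneg_right (Nat.cast_le.2 ?_) (by positivity)
  refine (card_le_card fun σ hσ => ?_).trans (card_image_le (f := Prod.fst))
  obtain ⟨τ, i, h1, h2⟩ := (mem_filter.1 hσ).2
  have hτ : Function.update σ i (τ i) = τ := by
    rw [Function.update_eq_iff]
    exact ⟨rfl, fun j hj => (h1 j hj).symm⟩
  exact mem_image.2 ⟨(σ, i, τ i), mem_filter.2 ⟨mem_univ _, by rw [hτ]; exact ⟨i, h1, h2⟩⟩, rfl⟩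

theorem pow_div_le_randomManipulationProb (hn : 2 ≤ n) (hk : 3 ≤ k) (f : SCF n k) (ε : ℝ)
    (hε : ε ≤ distToClass f (nonmanipBar n k)) :
    ε ^ 5 / (4 * (n : ℝ) ^ 8 * (k : ℝ) ^ 12 * (k.factorial : ℝ) ^ 5) ≤
      randomManipulationProb f := by
  refine le_trans ?_ (manipulationProb_div_le_randomManipulationProb f)
  have := div_le_div_of_nonneg_right (pow_div_le_manipulationProb hn hk f ε hε)
    (by positivity : (0 : ℝ) ≤ n * k.factorial)
  rw [div_div] at this
  convert this using 2
  ring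

/-- A factor `1/k ^ 12` may be replaced by `1/k! ^ 12`: for `ε > 0` this weakens the bound, as
`k ≤ k!`, and for `ε ≤ 0` the new bound is not positive. -/
theorem polynomial_le_of_pow_div_le (hk : 3 ≤ k) {ε P : ℝ} (hP : 0 ≤ P) (s t : ℕ)
    (h : ε ^ 5 / (4 * (n : ℝ) ^ s * (k : ℝ) ^ 12 * (k.factorial : ℝ) ^ t) ≤ P) :
    1 / 4 * ε ^ 5 * (1 / (n : ℝ)) ^ s * (1 / (k.factorial : ℝ)) ^ (12 + t) ≤ P := by
  have e : 1 / 4 * ε ^ 5 * (1 / (n : ℝ)) ^ s * (1 / (k.factorial : ℝ)) ^ (12 + t) =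
      ε ^ 5 * ((1 / (4 * (n : ℝ) ^ s)) * (1 / k.factorial) ^ 12 * (1 / k.factorial) ^ t) := by
    rw [one_div_pow (n : ℝ), pow_add]
    ring
  have e' : ε ^ 5 / (4 * (n : ℝ) ^ s * (k : ℝ) ^ 12 * (k.factorial : ℝ) ^ t) =
      ε ^ 5 * ((1 / (4 * (n : ℝ) ^ s)) * (1 / k) ^ 12 * (1 / k.factorial) ^ t) := by
    rw [one_div_pow (k : ℝ), one_div_pow (k.factorial : ℝ)]
    ring
  rw [e]
  rcases le_or_gt ε 0 with hε0 | hε0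
  · exact (mul_nonpos_of_nonpos_of_nonneg (Odd.pow_nonpos (by decide) hε0)
      (by positivity)).trans hP
  · refine le_trans ?_ (e' ▸ h)
    have hk0 : (0 : ℝ) < k := by exact_mod_cast (by omega : 0 < k)
    have hle : (k : ℝ) ≤ k.factorial := by exact_mod_cast Nat.self_le_factorial k
    gcongr

end SocialChoice

theorem theorem3p1 :
    -- explicit lower bounds
    (∀ (n k : ℕ), 2 ≤ n → 3 ≤ k → ∀ (f : SocialChoice.SCF n k) (ε : ℝ),
      ε ≤ SocialChoice.distToClass f (SocialChoice.nonmanipBar n k) →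
        ε ^ 5 / (4 * (n : ℝ) ^ 7 * (k : ℝ) ^ 12 * (k.factorial : ℝ) ^ 4)
            ≤ SocialChoice.manipulationProb f ∧
        ε ^ 5 / (4 * (n : ℝ) ^ 8 * (k : ℝ) ^ 12 * (k.factorial : ℝ) ^ 5)
            ≤ SocialChoice.randomManipulationProb f) ∧
    -- lower bounds that are polynomial in `ε`, `1/n` and `1/k!`; the polynomials are universal
    -- and positive at positive arguments
    (∃ p q : MvPolynomial (Fin 3) ℝ,
      (∀ x : Fin 3 → ℝ, (∀ i, 0 < x i) →
        0 < MvPolynomial.eval x p ∧ 0 < MvPolynomial.eval x q) ∧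
      ∀ (n k : ℕ), 2 ≤ n → 3 ≤ k → ∀ (f : SocialChoice.SCF n k) (ε : ℝ),
        ε ≤ SocialChoice.distToClass f (SocialChoice.nonmanipBar n k) →
          MvPolynomial.eval ![ε, 1 / (n : ℝ), 1 / (k.factorial : ℝ)] p
              ≤ SocialChoice.manipulationProb f ∧
          MvPolynomial.eval ![ε, 1 / (n : ℝ), 1 / (k.factorial : ℝ)] q
              ≤ SocialChoice.randomManipulationProb f) := by
  refine ⟨fun n k hn hk f ε hε => ⟨SocialChoice.pow_div_le_manipulationProb hn hk f ε hε,
    SocialChoice.pow_div_le_randomManipulationProb hn hk f ε hε⟩, ?_⟩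
  -- the factor `k ^ 12` of the explicit bounds is absorbed by `k! ^ 12`
  refine ⟨MvPolynomial.C (1 / 4) * MvPolynomial.X 0 ^ 5 * MvPolynomial.X 1 ^ 7 *
      MvPolynomial.X 2 ^ (12 + 4),
    MvPolynomial.C (1 / 4) * MvPolynomial.X 0 ^ 5 * MvPolynomial.X 1 ^ 8 *
      MvPolynomial.X 2 ^ (12 + 5), fun x hx => ?_, fun n k hn hk f ε hε => ?_⟩
  · have h0 := hx 0
    have h1 := hx 1
    have h2 := hx 2
    simp only [map_mul, map_pow, MvPolynomial.eval_C, MvPolynomial.eval_X]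
    constructor <;> positivity
  · simp only [map_mul, map_pow, MvPolynomial.eval_C, MvPolynomial.eval_X]
    exact ⟨SocialChoice.polynomial_le_of_pow_div_le hk (SocialChoice.uniformProb_nonneg _) 7 4
        (SocialChoice.pow_div_le_manipulationProb hn hk f ε hε),
      SocialChoice.polynomial_le_of_pow_div_le hk (SocialChoice.uniformProb_nonneg _) 8 5
        (SocialChoice.pow_div_le_randomManipulationProb hn hk f ε hε)⟩
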